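/- **Theorem (regret of Model-index Adaptive Posterior Sampling).** Let $\mathcal M$ be a finite class of models. Each $M\in\mathcal M$ maps a decision $\pi\in\Pi$ to a probability distribution $M(\pi)$ of an observation, with likelihood $o\mapsto[M(\pi)](o)$ with respect to a reference measure (possibly depending on $\pi$) common to all models, and has a mean reward function $f_M:\Pi\to[0,1]$ with a maximizer $\pi_M\in\arg\max_{\pi} f_M(\pi)$. For weights $w$ on $\mathcal M$ write $w_{o|\pi}=\sum_M w(M)M(\pi)$ and let $w_{\pi_M}$ be the law of $\pi_M$ for $M\sim w$, i.e. $w_{\pi_M}(\pi)=\sum_{M:\pi_M=\pi}w(M)$. Let $D_{\mathrm H}^2(P,Q)=\int(\sqrt{dP}-\sqrt{dQ})^2$ and, for $\gamma>0$, $$\mathrm{DEC}^{\mathrm{TS}}_{\gamma}(\mathcal M)=\sup_{\bar M\in\mathrm{conv}(\mathcal M)}\ \sup_{\mu\in\Delta(\mathcal M)}\ \mathbb E_{M\sim\mu,\ \pi\sim\mu_{\pi_M}}\Big[f_M(\pi_M)-f_M(\pi)-\tfrac1\gamma D_{\mathrm H}^2\big(M(\pi),\bar M(\pi)\big)\Big],$$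 where $M$ and $\pi$ are independent. Let $\eta\in(0,1/3]$. Given the distributions $p_t$ from which an algorithm draws its decisions, set $\rho_1=\mathrm{Unif}(\mathcal M)$ and, for $t\ge1$, $$\mu_t(M)\propto\rho_t(M)\exp\Big(\eta\big(f_M(\pi_M)-\mathbb E_{\pi\sim p_t}[f_M(\pi)]\big)-\tfrac13\,\mathbb E_{\pi\sim p_t}\big[D_{\mathrm H}^2(M(\pi),(\rho_t)_{o|\pi})\big]\Big),\qquad \rho_{t+1}(M)\propto\mu_t(M)\,[M(\pi_t)](o_t),$$ where $\pi_t\sim p_t$ is the decision and $o_t$ the observation of round $t$ (if all the products $\mu_t(M)[M(\pi_t)](o_t)$ vanish, put $\rho_{t+1}=\mu_t$). MAPS is the algorithm that plays, in every round, the decision distribution induced by its current belief, $p_t=(\rho_t)_{\pi_M}$. The same bound is claimed for every (history-dependent, measurable) algorithm that satisfies instead the implicit equation $p_t=(\mu_t)_{\pi_M}$ in every round. Suppose that the environment is stochastic: $o_t\sim M^*(\pi_t)$ in all rounds, for a fixed $M^*\in\mathcal M$. Then, for all $T\in\mathbb N$, the regret $\mathrm{Reg}_T=\sup_{\pi^*\in\Pi}\mathbb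 E\big[\sum_{t=1}^T f_{M^*}(\pi^*)-\sum_{t=1}^T f_{M^*}(\pi_t)\big]$ satisfies $$\mathrm{Reg}_T\le\frac{\log|\mathcal M|}{\eta}+\mathrm{DEC}^{\mathrm{TS}}_{6\eta}(\mathcal M)\cdot T+6\eta T.$$ -/

import Mathlib

open MeasureTheory ProbabilityTheory

noncomputable section

/-- Squared Hellinger distance `∫ (√dP - √dQ)²`, with both measures written through their
densities with respect to the dominating measure `P + Q`. -/
def hellingerSq {Obs : Type*} [MeasurableSpace Obs] (P Q : Measure Obs) : ℝ :=
  ∫ o, (√(P.rnDeriv (P + Q) o).toReal - √(Q.rnDeriv (P + Q) o).toReal) ^ 2 ∂(P + Q)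

/-- A class of models indexed by `ι`. Model `i` maps a decision `π` to the law `model i π` of the
observation. `lik i π` is a likelihood function of that law, with respect to a
reference measure `base π` which is common to all the models (for finite `ι` one may always take
the sum of the laws `model j π`). `opt i` is an optimal decision of model `i`. -/
structure ModelClass (ι Dec Obs : Type*) [MeasurableSpace Dec] [MeasurableSpace Obs] where
  model : ι → Kernel Dec Obs
  isMarkov : ∀ i, IsMarkovKernel (model i)
  base : Dec → Measure Obs
  lik : ι → Dec → Obs → NNReal
  measurable_lik : ∀ i, Measurable (fun x : Dec × Obs => lik i x.1 x.2)
  model_eq : ∀ i π, model i π = (base π).withDensity (fun o => (lik i π o : ENNReal))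
  meanReward : ι → Dec → ℝ
  measurable_meanReward : ∀ i, Measurable (meanReward i)
  opt : ι → Dec
  meanReward_le_opt : ∀ i π, meanReward i π ≤ meanReward i (opt i)

/-- An admissible algorithm: it maps the past decisions and observations to a probability
distribution over decisions. Rounds are numbered from `0`, so round `t` sees `t` past pairs. -/
structure Algorithm (Dec Obs : Type*) [MeasurableSpace Dec] [MeasurableSpace Obs] where
  play : (t : ℕ) → Kernel (Fin t → Dec × Obs) Dec
  isMarkov : ∀ t, IsMarkovKernel (play t)

namespace ModelClass

variable {ι Dec Obs : Type*} [Fintype ι] [MeasurableSpace Dec] [MeasurableSpace Obs]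

/-- The law of the observation after decision `π` when the model is drawn from the weights `w`.
As `w` ranges over the simplex, these are the elements of the convex hull of the class. -/
def mixture (C : ModelClass ι Dec Obs) (w : ι → ℝ) (π : Dec) : Measure Obs :=
  ∑ i, ENNReal.ofReal (w i) • C.model i π

/-- The law of the optimal decision of a model that is drawn from the weights `w`. -/
def inducedDecision (C : ModelClass ι Dec Obs) (w : ι → ℝ) : Measure Dec :=
  ∑ i, ENNReal.ofReal (w i) • Measure.dirac (C.opt i)

/-- Unnormalized closed-form algorithmic belief for learning rate `η`, decision distribution `p`
and reference distribution `ρ` over the models. -/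
def beliefWeight (C : ModelClass ι Dec Obs) (η : ℝ) (p : Measure Dec) (ρ : ι → ℝ) (i : ι) : ℝ :=
  ρ i * Real.exp (η * (C.meanReward i (C.opt i) - ∫ π, C.meanReward i π ∂p)
    - 1 / 3 * ∫ π, hellingerSq (C.model i π) (C.mixture ρ π) ∂p)

/-- Closed-form algorithmic belief. -/
def closedFormBelief (C : ModelClass ι Dec Obs) (η : ℝ) (p : Measure Dec) (ρ : ι → ℝ) (i : ι) : ℝ :=
  C.beliefWeight η p ρ i / ∑ j, C.beliefWeight η p ρ j

open Classical in
/-- Bayesian posterior over the models, from the prior `μ`, after decision `π` and observation `o`.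
If the pair has likelihood zero under all the models that `μ` charges (an event of probability
zero under each of them), the prior is kept. -/
def posterior (C : ModelClass ι Dec Obs) (μ : ι → ℝ) (π : Dec) (o : Obs) (i : ι) : ℝ :=
  if ∑ j, μ j * (C.lik j π o : ℝ) = 0 then μ i
  else μ i * (C.lik i π o : ℝ) / ∑ j, μ j * (C.lik j π o : ℝ)

/-- The reference distributions that go with an algorithm: uniform in the first round, and then the
posterior of the closed-form belief of the round before. -/
def reference (C : ModelClass ι Dec Obs) (η : ℝ) (alg : Algorithm Dec Obs) :
    (t : ℕ) → (Fin t → Dec × Obs) → ι → ℝ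
  | 0, _ => fun _ => 1 / (Fintype.card ι : ℝ)
  | t + 1, h =>
      C.posterior
        (C.closedFormBelief η (alg.play t (Fin.init h)) (C.reference η alg t (Fin.init h)))
        (h (Fin.last t)).1 (h (Fin.last t)).2

/-- The closed-form algorithmic belief of round `t` that goes with an algorithm. -/
def belief (C : ModelClass ι Dec Obs) (η : ℝ) (alg : Algorithm Dec Obs) (t : ℕ)
    (h : Fin t → Dec × Obs) : ι → ℝ :=
  C.closedFormBelief η (alg.play t h) (C.reference η alg t h)

/-- The algorithm is Model-index Adaptive Posterior Sampling: in every round it draws a model from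
its current belief and plays the optimal decision of that model. The current belief is the posterior
`reference` that the round starts with. The second alternative is the implicit scheme
in which the belief `belief` of the same round, which itself depends on the decision
distribution, is used instead. -/
def IsMAPS (C : ModelClass ι Dec Obs) (η : ℝ) (alg : Algorithm Dec Obs) : Prop :=
  (∀ t h, alg.play t h = C.inducedDecision (C.reference η alg t h)) ∨
  (∀ t h, alg.play t h = C.inducedDecision (C.belief η alg t h))

/-- Bayesian decision-estimation coefficient of Thompson sampling: model and decision are
independent, the model has law `μ` and the decision has the law of the optimal decision
of a model drawn from `μ`. -/
def decTS (C : ModelClass ι Dec Obs) (η : ℝ) : ℝ :=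
  ⨆ w : stdSimplex ℝ ι, ⨆ μ : stdSimplex ℝ ι,
    ∫ π, ∑ i, μ.1 i * (C.meanReward i (C.opt i) - C.meanReward i π
      - 1 / η * hellingerSq (C.model i π) (C.mixture w.1 π)) ∂(C.inducedDecision μ.1)

end ModelClass

/-- The law of the first `t` decisions and observations when the algorithm plays against the
observation kernel `K` in all rounds. -/
def Algorithm.law {Dec Obs : Type*} [MeasurableSpace Dec] [MeasurableSpace Obs]
    (alg : Algorithm Dec Obs) (K : Kernel Dec Obs) : (t : ℕ) → Measure (Fin t → Dec × Obs)
  | 0 => Measure.dirac Fin.elim0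
  | t + 1 =>
      (alg.law K t ⊗ₘ (alg.play t ⊗ₖ Kernel.prodMkLeft (Fin t → Dec × Obs) K)).map
        (fun x => (Fin.snoc x.1 x.2 : Fin (t + 1) → Dec × Obs))

/-- Frequentist regret after `T` rounds, in the stochastic environment whose model is `m`. -/
def ModelClass.regret {ι Dec Obs : Type*} [MeasurableSpace Dec] [MeasurableSpace Obs]
    (C : ModelClass ι Dec Obs) (alg : Algorithm Dec Obs) (m : ι) (T : ℕ) : ℝ :=
  ⨆ π' : Dec, ∫ h, (∑ _t : Fin T, C.meanReward m π' - ∑ t : Fin T, C.meanReward m (h t).1)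
    ∂(alg.law (C.model m) T)

end

/-! ### Squared Hellinger distance for laws with densities. -/

section Hellinger

variable {Obs : Type*} [MeasurableSpace Obs]

/-! The potential is the log loss `-log ρ_t(m)` of the true model `m`. It starts at `log |ι|` and is
never negative, so it suffices that in each round its expected increase plus `η` times the regret is
at most `η * decTS (6η) + 6η²`.

Bayes' rule at the true model gives (`lintegral_logLoss_le`): the expected new loss is at most `-log
μ_t(m)` minus the squared Hellinger distance from `m` to the `μ_t`-mixture. Write `μ = ρ exp(X) / Z`
with `X = η a - b / 3`, where `a` is a model's expected regret and `b` its expected squared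
Hellinger distance to the `ρ`-mixture. In `-log μ(m) = -log ρ(m) - X m + log Z` the term `η a`
cancels the regret. What remains is `log Z` plus a third of the distance to the `ρ`-mixture minus
the distance to the `μ`-mixture. A weighted triangle inequality and data processing bound that
difference by half the squared Hellinger distance of `μ` and `ρ` (`hellingerSq_mixture_le`), hence
by half of `KL(μ, ρ) = ∑ μ X - log Z` (`sum_sub_sqrt_sq_le`). The total is `(log Z + ∑ μ X) / 2`, in
which `m` no longer occurs.

If decisions follow `ρ`, Jensen bounds this by `(∑ ρ exp(2X) - 1) / 2`, and expanding the
exponential yields the DEC at `ρ` plus `2η²`. If they follow `μ`, then `KL ≥ 0` gives `log Z ≤ ∑ μ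
X`, and `∑ μ X` is at most `η` times the DEC objective at `μ`. In both cases the reference model of
the DEC is the `ρ`-mixture. -/

theorem hellingerSq_nonneg (P Q : Measure Obs) : 0 ≤ hellingerSq P Q :=
  integral_nonneg fun _ => sq_nonneg _

/-- The distance does not depend on the dominating measure: the derivatives with respect to `P + Q`
are `p / (p + q)` and `q / (p + q)`, and the common factor cancels because the integrand is
homogeneous of degree one. As `P + Q` is finite, `ν` need not be σ-finite. -/
theorem hellingerSq_withDensity {ν : Measure Obs} {p q : Obs → NNReal}
    (hp : Measurable p) (hq : Measurable q)
    [IsFiniteMeasure (ν.withDensity fun o => (p o : ENNReal))]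
    [IsFiniteMeasure (ν.withDensity fun o => (q o : ENNReal))] :
    hellingerSq (ν.withDensity fun o => (p o : ENNReal)) (ν.withDensity fun o => (q o : ENNReal))
      = ∫ o, (√(p o : ℝ) - √(q o : ℝ)) ^ 2 ∂ν := by
  have hsum : (ν.withDensity fun o => (p o : ENNReal)) + (ν.withDensity fun o => (q o : ENNReal))
      = ν.withDensity fun o => ((p o + q o : NNReal) : ENNReal) := by
    rw [← withDensity_add_left hp.coe_nnreal_ennreal]
    rfl
  have hr : Measurable fun o => p o + q o := hp.add hq
  have hd : ∀ f : Obs → NNReal, Measurable f → Measurable fun o => f o / (p o + q o) :=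
    fun f hf => hf.div hr
  have key : ∀ f : Obs → NNReal, Measurable f → (∀ o, f o ≤ p o + q o) →
      (ν.withDensity fun o => (f o : ENNReal))
        = (ν.withDensity fun o => ((p o + q o : NNReal) : ENNReal)).withDensity
            (fun o => ((f o / (p o + q o) : NNReal) : ENNReal)) := by
    intro f hf hle
    rw [← withDensity_mul _ hr.coe_nnreal_ennreal (hd f hf).coe_nnreal_ennreal]
    congr 1
    ext o
    rw [Pi.mul_apply, ← ENNReal.coe_mul]
    congr 1
    rcases eq_or_ne (p o + q o) 0 with h | h
    · have := hle o
      rw [h] at this ⊢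
      simpa using this
    · rw [mul_div_cancel₀ _ h]
  have hfin : IsFiniteMeasure (ν.withDensity fun o => ((p o + q o : NNReal) : ENNReal)) := by
    rw [← hsum]; infer_instance
  have hP := Measure.rnDeriv_withDensity
    (ν.withDensity fun o => ((p o + q o : NNReal) : ENNReal))
    (hd p hp).coe_nnreal_ennreal
  have hQ := Measure.rnDeriv_withDensity
    (ν.withDensity fun o => ((p o + q o : NNReal) : ENNReal))
    (hd q hq).coe_nnreal_ennreal
  rw [hellingerSq, hsum]
  rw [← key p hp fun o => le_self_add] at hP
  rw [← key q hq fun o => le_add_self] at hQ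
  have h1 : ∫ o, (√((ν.withDensity fun o => (p o : ENNReal)).rnDeriv
        (ν.withDensity fun o => ((p o + q o : NNReal) : ENNReal)) o).toReal
      - √((ν.withDensity fun o => (q o : ENNReal)).rnDeriv
        (ν.withDensity fun o => ((p o + q o : NNReal) : ENNReal)) o).toReal) ^ 2
        ∂(ν.withDensity fun o => ((p o + q o : NNReal) : ENNReal))
      = ∫ o, (√((p o : ℝ) / (p o + q o)) - √((q o : ℝ) / (p o + q o))) ^ 2
        ∂(ν.withDensity fun o => ((p o + q o : NNReal) : ENNReal)) := by
    apply integral_congr_ae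
    filter_upwards [hP, hQ] with o h1 h2
    rw [h1, h2]
    simp
  rw [h1, integral_withDensity_eq_integral_smul hr]
  congr 1
  ext o
  rw [NNReal.smul_def, NNReal.coe_add, smul_eq_mul,
    Real.sqrt_div (p o).coe_nonneg, Real.sqrt_div (q o).coe_nonneg, ← sub_div, div_pow,
    Real.sq_sqrt (add_nonneg (p o).coe_nonneg (q o).coe_nonneg)]
  rcases eq_or_ne ((p o : ℝ) + q o) 0 with h | h
  · have h1 : (p o : ℝ) = 0 := by linarith [(p o).coe_nonneg, (q o).coe_nonneg]
    have h2 : (q o : ℝ) = 0 := by linarith [(p o).coe_nonneg, (q o).coe_nonneg]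
    simp [h1, h2]
  · rw [mul_div_cancel₀ _ h]

theorem integrable_of_isFiniteMeasure_withDensity {ν : Measure Obs} {p : Obs → NNReal}
    (hp : Measurable p) [hP : IsFiniteMeasure (ν.withDensity fun o => (p o : ENNReal))] :
    Integrable (fun o => (p o : ℝ)) ν := by
  refine ⟨hp.coe_nnreal_real.aestronglyMeasurable, ?_⟩
  rw [hasFiniteIntegral_iff_enorm]
  have := hP.measure_univ_lt_top
  rw [withDensity_apply _ MeasurableSet.univ, Measure.restrict_univ] at this
  refine lt_of_eq_of_lt (lintegral_congr fun o => ?_) this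
  simp

theorem integral_density_eq_one {ν : Measure Obs} {p : Obs → NNReal}
    (hp : Measurable p) [hP : IsProbabilityMeasure (ν.withDensity fun o => (p o : ENNReal))] :
    ∫ o, (p o : ℝ) ∂ν = 1 := by
  have h := integral_withDensity_eq_integral_smul (μ := ν) hp (fun _ => (1 : ℝ))
  simpa [NNReal.smul_def] using h.symm

theorem integrable_sqrt_mul_sqrt {ν : Measure Obs} {p q : Obs → NNReal}
    (hp : Measurable p) (hq : Measurable q)
    [IsFiniteMeasure (ν.withDensity fun o => (p o : ENNReal))]
    [IsFiniteMeasure (ν.withDensity fun o => (q o : ENNReal))] :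
    Integrable (fun o => √(p o : ℝ) * √(q o : ℝ)) ν := by
  refine ((integrable_of_isFiniteMeasure_withDensity hp).add
    (integrable_of_isFiniteMeasure_withDensity hq)).mono'
    (hp.coe_nnreal_real.sqrt.mul hq.coe_nnreal_real.sqrt).aestronglyMeasurable
    (ae_of_all _ fun o => ?_)
  rw [Real.norm_of_nonneg (by positivity)]
  have h1 := Real.sq_sqrt (p o).coe_nonneg
  have h2 := Real.sq_sqrt (q o).coe_nonneg
  simp only [Pi.add_apply]
  nlinarith [sq_nonneg (√(p o : ℝ) - √(q o : ℝ)), (p o).coe_nonneg, (q o).coe_nonneg]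

theorem sub_sqrt_sq (a b : NNReal) :
    (√(a : ℝ) - √(b : ℝ)) ^ 2 = (a : ℝ) + b - 2 * (√(a : ℝ) * √(b : ℝ)) := by
  have h1 := Real.sq_sqrt a.coe_nonneg
  have h2 := Real.sq_sqrt b.coe_nonneg
  linear_combination h1 + h2

theorem integrable_sub_sqrt_sq {ν : Measure Obs} {p q : Obs → NNReal}
    (hp : Measurable p) (hq : Measurable q)
    [IsFiniteMeasure (ν.withDensity fun o => (p o : ENNReal))]
    [IsFiniteMeasure (ν.withDensity fun o => (q o : ENNReal))] :
    Integrable (fun o => (√(p o : ℝ) - √(q o : ℝ)) ^ 2) ν := by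
  simp_rw [sub_sqrt_sq]
  exact ((integrable_of_isFiniteMeasure_withDensity hp).add
    (integrable_of_isFiniteMeasure_withDensity hq)).sub
    ((integrable_sqrt_mul_sqrt hp hq).const_mul 2)

/-- The squared Hellinger distance in terms of the Hellinger affinity. -/
theorem hellingerSq_withDensity_eq_affinity {ν : Measure Obs} {p q : Obs → NNReal}
    (hp : Measurable p) (hq : Measurable q)
    [IsProbabilityMeasure (ν.withDensity fun o => (p o : ENNReal))]
    [IsProbabilityMeasure (ν.withDensity fun o => (q o : ENNReal))] :
    hellingerSq (ν.withDensity fun o => (p o : ENNReal)) (ν.withDensity fun o => (q o : ENNReal))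
      = 2 - 2 * ∫ o, √(p o : ℝ) * √(q o : ℝ) ∂ν := by
  rw [hellingerSq_withDensity hp hq]
  simp_rw [sub_sqrt_sq]
  have hadd : Integrable (fun o => (p o : ℝ) + q o) ν :=
    (integrable_of_isFiniteMeasure_withDensity hp).add
      (integrable_of_isFiniteMeasure_withDensity hq)
  rw [integral_sub hadd ((integrable_sqrt_mul_sqrt hp hq).const_mul 2),
    integral_add (integrable_of_isFiniteMeasure_withDensity hp)
    (integrable_of_isFiniteMeasure_withDensity hq), integral_const_mul,
    integral_density_eq_one hp, integral_density_eq_one hq]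
  norm_num

theorem hellingerSq_withDensity_le_two {ν : Measure Obs} {p q : Obs → NNReal}
    (hp : Measurable p) (hq : Measurable q)
    [IsProbabilityMeasure (ν.withDensity fun o => (p o : ENNReal))]
    [IsProbabilityMeasure (ν.withDensity fun o => (q o : ENNReal))] :
    hellingerSq (ν.withDensity fun o => (p o : ENNReal)) (ν.withDensity fun o => (q o : ENNReal))
      ≤ 2 := by
  rw [hellingerSq_withDensity_eq_affinity hp hq]
  have : 0 ≤ ∫ o, √(p o : ℝ) * √(q o : ℝ) ∂ν := integral_nonneg fun o => by positivity
  linarith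

/-- A weighted form of the triangle inequality for the Hellinger distance. -/
theorem hellingerSq_withDensity_triangle {ν : Measure Obs} {p q r : Obs → NNReal}
    (hp : Measurable p) (hq : Measurable q) (hr : Measurable r)
    [IsFiniteMeasure (ν.withDensity fun o => (p o : ENNReal))]
    [IsFiniteMeasure (ν.withDensity fun o => (q o : ENNReal))]
    [IsFiniteMeasure (ν.withDensity fun o => (r o : ENNReal))] :
    hellingerSq (ν.withDensity fun o => (p o : ENNReal)) (ν.withDensity fun o => (r o : ENNReal))
      ≤ 3 * hellingerSq (ν.withDensity fun o => (p o : ENNReal))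
          (ν.withDensity fun o => (q o : ENNReal))
        + 3 / 2 * hellingerSq (ν.withDensity fun o => (q o : ENNReal))
          (ν.withDensity fun o => (r o : ENNReal)) := by
  rw [hellingerSq_withDensity hp hq, hellingerSq_withDensity hp hr, hellingerSq_withDensity hq hr,
    ← integral_const_mul, ← integral_const_mul,
    ← integral_add ((integrable_sub_sqrt_sq hp hq).const_mul 3)
      ((integrable_sub_sqrt_sq hq hr).const_mul _)]
  refine integral_mono (integrable_sub_sqrt_sq hp hr)
    (((integrable_sub_sqrt_sq hp hq).const_mul 3).add
      ((integrable_sub_sqrt_sq hq hr).const_mul _)) fun o => ?_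
  dsimp only
  -- `(x + y)² ≤ 3 x² + (3/2) y²`; the gap is `(2x - y)² / 2`.
  nlinarith [sq_nonneg (2 * (√(p o : ℝ) - √(q o : ℝ)) - (√(q o : ℝ) - √(r o : ℝ)))]

/-- Data processing: mixing does not increase the squared Hellinger distance of the weights. -/
theorem hellingerSq_withDensity_mixture_le {ι : Type*} [Fintype ι] {ν : Measure Obs}
    {q : ι → Obs → NNReal} (hq : ∀ i, Measurable (q i))
    (hP : ∀ i, IsProbabilityMeasure (ν.withDensity fun o => (q i o : ENNReal)))
    (a b : ι → NNReal)
    [IsFiniteMeasure (ν.withDensity fun o => ((∑ i, a i * q i o : NNReal) : ENNReal))]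
    [IsFiniteMeasure (ν.withDensity fun o => ((∑ i, b i * q i o : NNReal) : ENNReal))] :
    hellingerSq (ν.withDensity fun o => ((∑ i, a i * q i o : NNReal) : ENNReal))
        (ν.withDensity fun o => ((∑ i, b i * q i o : NNReal) : ENNReal))
      ≤ ∑ i, (√(a i : ℝ) - √(b i : ℝ)) ^ 2 := by
  have hm : ∀ c : ι → NNReal, Measurable fun o => ∑ i, c i * q i o := fun c =>
    Finset.measurable_sum _ fun i _ => (hq i).const_mul (c i)
  rw [hellingerSq_withDensity (hm a) (hm b)]
  have hint : ∀ i, Integrable (fun o => (√(a i : ℝ) - √(b i : ℝ)) ^ 2 * (q i o : ℝ)) ν :=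
    fun i => (integrable_of_isFiniteMeasure_withDensity (hq i)).const_mul _
  have hsum : ∑ i, (√(a i : ℝ) - √(b i : ℝ)) ^ 2
      = ∫ o, ∑ i, (√(a i : ℝ) - √(b i : ℝ)) ^ 2 * (q i o : ℝ) ∂ν := by
    rw [integral_finsetSum _ fun i _ => hint i]
    refine Finset.sum_congr rfl fun i _ => ?_
    rw [integral_const_mul, integral_density_eq_one (hq i), mul_one]
  rw [hsum]
  refine integral_mono (integrable_sub_sqrt_sq (hm a) (hm b))
    (integrable_finsetSum _ fun i _ => hint i) fun o => ?_
  dsimp only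
  -- Cauchy–Schwarz at a fixed observation: the affinity of the two mixtures dominates the sum of
  -- the componentwise affinities.
  have hcs := Real.sum_sqrt_mul_sqrt_le Finset.univ (f := fun i => ((a i * q i o : NNReal) : ℝ))
    (g := fun i => ((b i * q i o : NNReal) : ℝ)) (fun i => NNReal.coe_nonneg _)
    (fun i => NNReal.coe_nonneg _)
  rw [sub_sqrt_sq, NNReal.coe_sum, NNReal.coe_sum]
  have hexp : ∑ i, (√(a i : ℝ) - √(b i : ℝ)) ^ 2 * (q i o : ℝ)
      = ∑ i, ((a i * q i o : NNReal) : ℝ) + ∑ i, ((b i * q i o : NNReal) : ℝ)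
        - 2 * ∑ i, √((a i * q i o : NNReal) : ℝ) * √((b i * q i o : NNReal) : ℝ) := by
    rw [Finset.mul_sum, ← Finset.sum_add_distrib, ← Finset.sum_sub_distrib]
    refine Finset.sum_congr rfl fun i _ => ?_
    rw [sub_sqrt_sq, NNReal.coe_mul, NNReal.coe_mul, Real.sqrt_mul (a i).coe_nonneg,
      Real.sqrt_mul (b i).coe_nonneg]
    have h := Real.mul_self_sqrt (q i o).coe_nonneg
    linear_combination (2 * (√(a i : ℝ) * √(b i : ℝ))) * h
  rw [hexp]
  linarith

end Hellinger

/-! ### Logarithmic loss of a Bayesian update. -/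

noncomputable section

/-- The logarithmic loss `-log x` of a probability `x`, with value `∞` if `x ≤ 0`. -/
def logLoss (x : ℝ) : ENNReal := if x ≤ 0 then ⊤ else ENNReal.ofReal (-Real.log x)

theorem logLoss_of_pos {x : ℝ} (hx : 0 < x) : logLoss x = ENNReal.ofReal (-Real.log x) :=
  if_neg hx.not_ge

theorem log_le_two_mul_sqrt_sub_one {x : ℝ} (hx : 0 < x) : Real.log x ≤ 2 * (√x - 1) := by
  have h := Real.log_le_sub_one_of_pos (Real.sqrt_pos.2 hx)
  rw [Real.log_sqrt hx.le] at h
  linarith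

/-- The expected logarithmic loss of a posterior weight improves on that of the prior weight `c` by
at least the squared Hellinger distance from the predictive distribution. -/
theorem lintegral_logLoss_le {Obs : Type*} [MeasurableSpace Obs] {ν : Measure Obs}
    {p q : Obs → NNReal} (hp : Measurable p) (hq : Measurable q)
    [IsProbabilityMeasure (ν.withDensity fun o => (p o : ENNReal))]
    [IsProbabilityMeasure (ν.withDensity fun o => (q o : ENNReal))]
    {c : ℝ} (hc : 0 < c) (hle : ∀ o, c * (p o : ℝ) ≤ q o) :
    0 ≤ -Real.log c - hellingerSq (ν.withDensity fun o => (p o : ENNReal))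
        (ν.withDensity fun o => (q o : ENNReal)) ∧
    ∫⁻ o, logLoss (c * p o / q o) ∂(ν.withDensity fun o => (p o : ENNReal))
      ≤ ENNReal.ofReal (-Real.log c - hellingerSq (ν.withDensity fun o => (p o : ENNReal))
        (ν.withDensity fun o => (q o : ENNReal))) := by
  set P := ν.withDensity fun o => (p o : ENNReal) with hPdef
  -- Turns the `P`-mean of `√(q / p)` into the Hellinger affinity; where `a = 0` both sides vanish.
  have hmul : ∀ a b : NNReal, (a : ℝ) * √((b : ℝ) / a) = √(a : ℝ) * √(b : ℝ) := by
    intro a b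
    rcases eq_or_ne a 0 with rfl | ha
    · simp
    · have ha' : 0 < √(a : ℝ) := Real.sqrt_pos.2 (NNReal.coe_pos.2 (pos_iff_ne_zero.2 ha))
      have h := Real.mul_self_sqrt a.coe_nonneg
      rw [Real.sqrt_div b.coe_nonneg]
      rw [mul_div_assoc', div_eq_iff ha'.ne']
      linear_combination (-√(b : ℝ)) * h
  have hint : Integrable (fun o => √((q o : ℝ) / p o)) P := by
    rw [hPdef, integrable_withDensity_iff_integrable_smul hp]
    simp_rw [NNReal.smul_def, smul_eq_mul, hmul]
    exact integrable_sqrt_mul_sqrt hp hq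
  have hval : ∫ o, √((q o : ℝ) / p o) ∂P = ∫ o, √(p o : ℝ) * √(q o : ℝ) ∂ν := by
    rw [hPdef, integral_withDensity_eq_integral_smul hp]
    simp_rw [NNReal.smul_def, smul_eq_mul, hmul]
  have hpos : ∀ᵐ o ∂P, 0 < (p o : ℝ) := by
    rw [hPdef, ae_withDensity_iff hp.coe_nnreal_ennreal]
    refine ae_of_all _ fun o ho => ?_
    have : p o ≠ 0 := by simpa using ho
    exact NNReal.coe_pos.2 (pos_iff_ne_zero.2 this)
  have hg : ∀ᵐ o ∂P, logLoss (c * p o / q o)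
        ≤ ENNReal.ofReal (-Real.log c + 2 * (√((q o : ℝ) / p o) - 1)) ∧
      0 ≤ -Real.log c + 2 * (√((q o : ℝ) / p o) - 1) := by
    filter_upwards [hpos] with o ho
    have hqo : 0 < (q o : ℝ) := (mul_pos hc ho).trans_le (hle o)
    have hlog : Real.log (c * p o / q o) = Real.log c - Real.log ((q o : ℝ) / p o) := by
      rw [← Real.log_div hc.ne' (by positivity)]
      congr 1
      field_simp
    have h1 := log_le_two_mul_sqrt_sub_one (div_pos hqo ho)
    -- Since `q ≥ c p`, the posterior weight is at most one, so `ENNReal.ofReal` truncates nothing.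
    have h2 : Real.log (c * p o / q o) ≤ 0 :=
      Real.log_nonpos (by positivity) ((div_le_one hqo).2 (hle o))
    rw [logLoss_of_pos (by positivity)]
    exact ⟨ENNReal.ofReal_le_ofReal (by linarith), by linarith⟩
  have hgi : Integrable (fun o => -Real.log c + 2 * (√((q o : ℝ) / p o) - 1)) P :=
    (integrable_const _).add ((hint.sub (integrable_const _)).const_mul 2)
  have hH : -Real.log c - hellingerSq P (ν.withDensity fun o => (q o : ENNReal))
      = ∫ o, (-Real.log c + 2 * (√((q o : ℝ) / p o) - 1)) ∂P := by
    have hsub : Integrable (fun o => 2 * (√((q o : ℝ) / p o) - 1)) P :=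
      (hint.sub (integrable_const _)).const_mul 2
    rw [integral_add (integrable_const _) hsub,
      integral_const_mul, integral_sub hint (integrable_const _), hval, hPdef,
      hellingerSq_withDensity_eq_affinity hp hq]
    simp
    ring
  rw [hH]
  refine ⟨integral_nonneg_of_ae (hg.mono fun o ho => ho.2), ?_⟩
  rw [ofReal_integral_eq_lintegral_ofReal hgi (hg.mono fun o ho => ho.2)]
  exact lintegral_mono_ae (hg.mono fun o ho => ho.1)

end

/-! ### Integral inequalities without measurability. -/

section LowerIntegral

/-- For an arbitrary function `∫⁻` is a lower integral, attained by a measurable minorant; Tonelli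
for the minorant gives this one direction. It is the direction the induction needs, so measurability
of the beliefs in the history never has to be proved. -/
theorem lintegral_compProd_le {α β : Type*} [MeasurableSpace α] [MeasurableSpace β]
    (μ : Measure α) [SFinite μ] (κ : Kernel α β) [IsSFiniteKernel κ] (f : α × β → ENNReal) :
    ∫⁻ x, f x ∂(μ ⊗ₘ κ) ≤ ∫⁻ a, ∫⁻ b, f (a, b) ∂κ a ∂μ := by
  obtain ⟨g, hg, hgf, h⟩ := exists_measurable_le_lintegral_eq (μ ⊗ₘ κ) f
  rw [h, Measure.lintegral_compProd hg]
  exact lintegral_mono fun a => lintegral_mono fun b => hgf (a, b)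

theorem lintegral_kernel_compProd_le {α β γ : Type*} [MeasurableSpace α] [MeasurableSpace β]
    [MeasurableSpace γ] (κ : Kernel α β) [IsSFiniteKernel κ] (K : Kernel (α × β) γ)
    [IsSFiniteKernel K] (a : α) (f : β × γ → ENNReal) :
    ∫⁻ x, f x ∂((κ ⊗ₖ K) a) ≤ ∫⁻ b, ∫⁻ c, f (b, c) ∂K (a, b) ∂κ a := by
  obtain ⟨g, hg, hgf, h⟩ := exists_measurable_le_lintegral_eq ((κ ⊗ₖ K) a) f
  rw [h, Kernel.lintegral_compProd _ _ _ hg]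
  exact lintegral_mono fun a => lintegral_mono fun b => hgf (a, b)

theorem integral_le_toReal_lintegral_ofReal {α : Type*} [MeasurableSpace α] (μ : Measure α)
    (f : α → ℝ) : ∫ a, f a ∂μ ≤ (∫⁻ a, ENNReal.ofReal (f a) ∂μ).toReal := by
  by_cases hf : Integrable f μ
  · rw [integral_eq_lintegral_pos_part_sub_lintegral_neg_part hf]
    linarith [ENNReal.toReal_nonneg (a := ∫⁻ a, ENNReal.ofReal (-f a) ∂μ)]
  · rw [integral_undef hf]
    exact ENNReal.toReal_nonneg

end LowerIntegral

/-! ### Exponential weights. -/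

section ExponentialWeights

variable {ι : Type*} [Fintype ι]

theorem exp_sub_le {u v : ℝ} (hu : 0 ≤ u) (hu1 : u ≤ 1) (hv : 0 ≤ v) (hv1 : v ≤ 4 / 3) :
    Real.exp (u - v) ≤ 1 + u + u ^ 2 - v / 2 := by
  have h1 : Real.exp u ≤ 1 + u + u ^ 2 := by
    have := (abs_le.1 (Real.abs_exp_sub_one_sub_id_le (abs_le.2 ⟨by linarith, hu1⟩))).2
    linarith
  have h2 : Real.exp (-v) ≤ 1 - v / 2 := by
    rw [Real.exp_neg, inv_le_comm₀ (Real.exp_pos v) (by linarith)]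
    refine le_trans ?_ (Real.quadratic_le_exp_of_nonneg hv)
    rw [inv_le_iff_one_le_mul₀ (by linarith)]
    -- `(1 - v/2)(1 + v + v²/2) = 1 + v(2 - v²)/4`, which is at least one because `(4/3)² < 2`.
    nlinarith [mul_nonneg hv (by nlinarith : 0 ≤ 2 - v ^ 2)]
  rw [sub_eq_add_neg, Real.exp_add]
  calc Real.exp u * Real.exp (-v) ≤ (1 + u + u ^ 2) * (1 - v / 2) :=
        mul_le_mul h1 h2 (Real.exp_pos _).le (by positivity)
    _ ≤ _ := by nlinarith [mul_nonneg (add_nonneg hu (sq_nonneg u)) hv]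

/-- For exponential weights, the squared Hellinger distance from the prior is bounded by the
relative entropy. -/
theorem sum_sub_sqrt_sq_le {ρ μ X : ι → ℝ} {Z : ℝ} (hZ : 0 < Z) (hρ : ∀ i, 0 ≤ ρ i)
    (hρ1 : ∑ i, ρ i = 1) (hμ : ∀ i, μ i = ρ i * Real.exp (X i) / Z) (hμ1 : ∑ i, μ i = 1) :
    ∑ i, (√(μ i) - √(ρ i)) ^ 2 ≤ ∑ i, μ i * X i - Real.log Z := by
  -- With `y = X i - log Z`, the log-ratio of `μ i` to `ρ i`, one has `√(μ i * ρ i) = μ i *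
  -- exp(-y/2) ≥ μ i * (1 - y/2)`; no division by `ρ i` occurs.
  have key : ∀ i, (√(μ i) - √(ρ i)) ^ 2 ≤ μ i + ρ i - 2 * (μ i * (1 - (X i - Real.log Z) / 2)) := by
    intro i
    have hμ0 : 0 ≤ μ i := by rw [hμ]; have := hρ i; positivity
    have hρμ : ρ i = μ i * Real.exp (-(X i - Real.log Z) / 2) ^ 2 := by
      rw [← Real.exp_nat_mul, hμ]
      rw [show ((2 : ℕ) : ℝ) * (-(X i - Real.log Z) / 2) = Real.log Z - X i by push_cast; ring,
        Real.exp_sub, Real.exp_log hZ]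
      have := Real.exp_pos (X i)
      field_simp
    have hs : √(ρ i) = √(μ i) * Real.exp (-(X i - Real.log Z) / 2) := by
      conv_lhs => rw [hρμ]
      rw [Real.sqrt_mul hμ0, Real.sqrt_sq (Real.exp_pos _).le]
    have h1 := Real.add_one_le_exp (-(X i - Real.log Z) / 2)
    have h2 : √(μ i) * √(ρ i) = μ i * Real.exp (-(X i - Real.log Z) / 2) := by
      rw [hs, ← mul_assoc, Real.mul_self_sqrt hμ0]
    have h3 := mul_le_mul_of_nonneg_left h1 hμ0
    have h4 := Real.sq_sqrt hμ0
    have h5 := Real.sq_sqrt (hρ i)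
    nlinarith
  refine (Finset.sum_le_sum fun i _ => key i).trans (le_of_eq ?_)
  have : ∀ i, μ i + ρ i - 2 * (μ i * (1 - (X i - Real.log Z) / 2))
      = ρ i - μ i + (μ i * X i - μ i * Real.log Z) := fun i => by ring
  simp_rw [this]
  rw [Finset.sum_add_distrib, Finset.sum_sub_distrib, Finset.sum_sub_distrib, ← Finset.sum_mul,
    hρ1, hμ1]
  ring

/-- The normalization constant of exponential weights and their mean exponent, bounded by the
exponential moment of twice the exponent under the prior. -/
theorem log_add_sum_mul_le {ρ μ X : ι → ℝ} {Z : ℝ} (hZ : 0 < Z) (hρ : ∀ i, 0 ≤ ρ i)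
    (hμ : ∀ i, μ i = ρ i * Real.exp (X i) / Z) (hμ1 : ∑ i, μ i = 1) :
    Real.log Z + ∑ i, μ i * X i ≤ ∑ i, ρ i * Real.exp (2 * X i) - 1 := by
  have hμ0 : ∀ i, 0 ≤ μ i := fun i => by rw [hμ]; have := hρ i; positivity
  -- Jensen under `μ`: `exp(log Z + ∑ μ X) ≤ Z ∑ μ exp X = ∑ ρ exp(2X)`; then `x + 1 ≤ exp x`.
  have hJ := (convexOn_exp).map_sum_le (t := Finset.univ) (w := μ) (p := X) (fun i _ => hμ0 i) hμ1
    (fun i _ => Set.mem_univ _)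
  simp only [smul_eq_mul] at hJ
  have h1 := Real.add_one_le_exp (Real.log Z + ∑ i, μ i * X i)
  rw [Real.exp_add, Real.exp_log hZ] at h1
  have h2 : Z * ∑ i, μ i * Real.exp (X i) = ∑ i, ρ i * Real.exp (2 * X i) := by
    rw [Finset.mul_sum]
    refine Finset.sum_congr rfl fun i _ => ?_
    rw [hμ, two_mul, Real.exp_add]
    field_simp
  have h3 := mul_le_mul_of_nonneg_left hJ hZ.le
  linarith

end ExponentialWeights

/-! ### Densities, beliefs and the DEC of a model class. -/

noncomputable section

namespace ModelClass

theorem measurable_lik_section {ι Dec Obs : Type*} [MeasurableSpace Dec]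
    [MeasurableSpace Obs] (C : ModelClass ι Dec Obs) (i : ι) (π : Dec) :
    Measurable (C.lik i π) :=
  (C.measurable_lik i).comp (measurable_const.prodMk measurable_id)

variable {ι Dec Obs : Type*} [Fintype ι] [MeasurableSpace Dec] [MeasurableSpace Obs]

/-- The sum of the laws of all models, a finite measure that dominates each of them. -/
def sumLaw (C : ModelClass ι Dec Obs) (π : Dec) : Measure Obs := ∑ j, C.model j π

/-- The density of a model with respect to the sum of the laws of all models. -/
def density (C : ModelClass ι Dec Obs) (i : ι) (π : Dec) (o : Obs) : NNReal :=
  C.lik i π o / ∑ j, C.lik j π o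

theorem measurable_sum_lik (C : ModelClass ι Dec Obs) (π : Dec) :
    Measurable fun o => ∑ j, C.lik j π o :=
  Finset.measurable_sum _ fun j _ => C.measurable_lik_section j π

theorem measurable_density (C : ModelClass ι Dec Obs) (i : ι) (π : Dec) :
    Measurable (C.density i π) :=
  (C.measurable_lik_section i π).div (C.measurable_sum_lik π)

theorem withDensity_sum_mul (ν : Measure Obs) {q : ι → Obs → NNReal}
    (hq : ∀ i, Measurable (q i)) (c : ι → NNReal) :
    ∑ i, (c i : ENNReal) • ν.withDensity (fun o => (q i o : ENNReal))
      = ν.withDensity fun o => ((∑ i, c i * q i o : NNReal) : ENNReal) := by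
  ext s hs
  simp only [Measure.coe_finsetSum, Finset.sum_apply, Measure.smul_apply, smul_eq_mul,
    withDensity_apply _ hs]
  push_cast
  rw [lintegral_finsetSum _ fun i _ => ((hq i).coe_nnreal_ennreal.const_mul _)]
  refine Finset.sum_congr rfl fun i _ => ?_
  rw [lintegral_const_mul _ (hq i).coe_nnreal_ennreal]

theorem sumLaw_eq (C : ModelClass ι Dec Obs) (π : Dec) :
    C.sumLaw π = (C.base π).withDensity fun o => ((∑ j, C.lik j π o : NNReal) : ENNReal) := by
  have h := withDensity_sum_mul (C.base π) (fun i => C.measurable_lik_section i π) (fun _ => 1)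
  simp only [ENNReal.coe_one, one_smul, one_mul] at h
  rw [← h, sumLaw]
  exact Finset.sum_congr rfl fun i _ => C.model_eq i π

theorem model_eq_withDensity (C : ModelClass ι Dec Obs) (i : ι) (π : Dec) :
    C.model i π = (C.sumLaw π).withDensity fun o => (C.density i π o : ENNReal) := by
  rw [C.sumLaw_eq, C.model_eq, ← withDensity_mul _ (C.measurable_sum_lik π).coe_nnreal_ennreal
    (C.measurable_density i π).coe_nnreal_ennreal]
  congr 1
  ext o
  rw [Pi.mul_apply, ← ENNReal.coe_mul]
  congr 1
  have hle : C.lik i π o ≤ ∑ j, C.lik j π o :=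
    Finset.single_le_sum (f := fun j => C.lik j π o) (fun _ _ => zero_le) (Finset.mem_univ i)
  rw [density]
  rcases eq_or_ne (∑ j, C.lik j π o) 0 with h | h
  · rw [h] at hle ⊢
    simpa using hle
  · rw [mul_div_cancel₀ _ h]

theorem mixture_eq_withDensity (C : ModelClass ι Dec Obs) (w : ι → ℝ) (π : Dec) :
    C.mixture w π = (C.sumLaw π).withDensity
      fun o => ((∑ i, (w i).toNNReal * C.density i π o : NNReal) : ENNReal) := by
  rw [← withDensity_sum_mul _ (fun i => C.measurable_density i π), mixture]
  refine Finset.sum_congr rfl fun i _ => ?_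
  rw [C.model_eq_withDensity]
  rfl

theorem sum_ofReal_eq_one {w : ι → ℝ} (hw : w ∈ stdSimplex ℝ ι) :
    ∑ i, ENNReal.ofReal (w i) = 1 := by
  rw [← ENNReal.ofReal_sum_of_nonneg fun i _ => hw.1 i, hw.2, ENNReal.ofReal_one]

theorem isProbabilityMeasure_mixture (C : ModelClass ι Dec Obs) {w : ι → ℝ}
    (hw : w ∈ stdSimplex ℝ ι) (π : Dec) : IsProbabilityMeasure (C.mixture w π) := by
  have := C.isMarkov
  refine ⟨?_⟩
  simp [mixture, sum_ofReal_eq_one hw]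

theorem measurable_mixture_density (C : ModelClass ι Dec Obs) (w : ι → ℝ) (π : Dec) :
    Measurable fun o => ∑ i, (w i).toNNReal * C.density i π o :=
  Finset.measurable_sum _ fun i _ => (C.measurable_density i π).const_mul _

theorem hellingerSq_model_mixture_le_two (C : ModelClass ι Dec Obs) {w : ι → ℝ}
    (hw : w ∈ stdSimplex ℝ ι) (i : ι) (π : Dec) :
    hellingerSq (C.model i π) (C.mixture w π) ≤ 2 := by
  have h1 : IsProbabilityMeasure (C.model i π) := (C.isMarkov i).isProbabilityMeasure π
  have h2 := C.isProbabilityMeasure_mixture hw π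
  rw [C.model_eq_withDensity] at h1 ⊢
  rw [C.mixture_eq_withDensity] at h2 ⊢
  exact hellingerSq_withDensity_le_two (C.measurable_density i π)
    (C.measurable_mixture_density w π)

/-- A third of the weighted triangle inequality through the `μ`-mixture, with data processing for
the second leg. The factor `1/3` in the belief's exponent is matched to the triangle constant `3`.
-/
theorem hellingerSq_mixture_le (C : ModelClass ι Dec Obs) {ρ μ : ι → ℝ}
    (hρ : ρ ∈ stdSimplex ℝ ι) (hμ : μ ∈ stdSimplex ℝ ι) (i : ι) (π : Dec) :
    1 / 3 * hellingerSq (C.model i π) (C.mixture ρ π) - hellingerSq (C.model i π) (C.mixture μ π)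
      ≤ 1 / 2 * ∑ i, (√(μ i) - √(ρ i)) ^ 2 := by
  have h1 : ∀ i, IsProbabilityMeasure (C.model i π) :=
    fun i => (C.isMarkov i).isProbabilityMeasure π
  have h2 := C.isProbabilityMeasure_mixture hρ π
  have h3 := C.isProbabilityMeasure_mixture hμ π
  simp only [C.model_eq_withDensity] at h1 ⊢
  have hi := h1 i
  rw [C.mixture_eq_withDensity] at h2 h3
  rw [C.mixture_eq_withDensity, C.mixture_eq_withDensity]
  have htri := hellingerSq_withDensity_triangle (ν := C.sumLaw π) (C.measurable_density i π)
    (C.measurable_mixture_density μ π) (C.measurable_mixture_density ρ π)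
  have hdata := hellingerSq_withDensity_mixture_le (ν := C.sumLaw π)
    (fun i => C.measurable_density i π) h1 (fun i => (μ i).toNNReal) (fun i => (ρ i).toNNReal)
  simp only [Real.coe_toNNReal _ (hρ.1 _), Real.coe_toNNReal _ (hμ.1 _)] at hdata
  linarith

theorem lintegral_logLoss_posterior_le (C : ModelClass ι Dec Obs) {μ : ι → ℝ}
    (hμ : μ ∈ stdSimplex ℝ ι) {m : ι} (hm : 0 < μ m) (π : Dec) :
    0 ≤ -Real.log (μ m) - hellingerSq (C.model m π) (C.mixture μ π) ∧
    ∫⁻ o, logLoss (C.posterior μ π o m) ∂(C.model m π)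
      ≤ ENNReal.ofReal (-Real.log (μ m) - hellingerSq (C.model m π) (C.mixture μ π)) := by
  have h1 : IsProbabilityMeasure (C.model m π) := (C.isMarkov m).isProbabilityMeasure π
  have h2 := C.isProbabilityMeasure_mixture hμ π
  have hpos : ∀ᵐ o ∂(C.model m π), 0 < C.lik m π o := by
    rw [C.model_eq, ae_withDensity_iff (C.measurable_lik_section m π).coe_nnreal_ennreal]
    refine ae_of_all _ fun o ho => ?_
    exact pos_iff_ne_zero.2 (by simpa using ho)
  have hcongr : ∫⁻ o, logLoss (C.posterior μ π o m) ∂(C.model m π)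
      = ∫⁻ o, logLoss (μ m * C.density m π o
        / ((∑ i, (μ i).toNNReal * C.density i π o : NNReal) : ℝ)) ∂(C.model m π) := by
    refine lintegral_congr_ae ?_
    filter_upwards [hpos] with o ho
    have hS : 0 < ∑ j, (C.lik j π o : ℝ) :=
      Finset.sum_pos' (fun j _ => NNReal.coe_nonneg _) ⟨m, Finset.mem_univ m, ho⟩
    have hD : 0 < ∑ j, μ j * (C.lik j π o : ℝ) :=
      Finset.sum_pos' (fun j _ => mul_nonneg (hμ.1 j) (NNReal.coe_nonneg _))
        ⟨m, Finset.mem_univ m, mul_pos hm ho⟩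
    -- Replacing likelihoods by densities divides numerator and denominator of Bayes' rule by the
    -- same positive number.
    have hsum : ((∑ i, (μ i).toNNReal * C.density i π o : NNReal) : ℝ)
        = (∑ j, μ j * (C.lik j π o : ℝ)) / ∑ j, (C.lik j π o : ℝ) := by
      push_cast
      rw [Finset.sum_div]
      refine Finset.sum_congr rfl fun i _ => ?_
      rw [Real.coe_toNNReal _ (hμ.1 i), density]
      push_cast
      rw [mul_div_assoc]
    rw [posterior, if_neg hD.ne', hsum, density]
    push_cast
    congr 1
    field_simp
  rw [hcongr]
  rw [C.mixture_eq_withDensity] at h2 ⊢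
  rw [C.model_eq_withDensity] at h1 ⊢
  refine lintegral_logLoss_le (C.measurable_density m π) (C.measurable_mixture_density μ π) hm
    fun o => ?_
  push_cast
  refine le_trans (le_of_eq ?_) (Finset.single_le_sum
    (f := fun i => ((μ i).toNNReal : ℝ) * (C.density i π o : ℝ)) (fun i _ => by positivity)
    (Finset.mem_univ m))
  simp [hm.le]

theorem beliefWeight_nonneg (C : ModelClass ι Dec Obs) {η : ℝ} {p : Measure Dec} {ρ : ι → ℝ}
    (hρ : ρ ∈ stdSimplex ℝ ι) (i : ι) : 0 ≤ C.beliefWeight η p ρ i :=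
  mul_nonneg (hρ.1 i) (Real.exp_pos _).le

theorem sum_beliefWeight_pos (C : ModelClass ι Dec Obs) {η : ℝ} {p : Measure Dec} {ρ : ι → ℝ}
    (hρ : ρ ∈ stdSimplex ℝ ι) : 0 < ∑ i, C.beliefWeight η p ρ i := by
  obtain ⟨i, -, hi⟩ : ∃ i ∈ Finset.univ, 0 < ρ i := by
    apply Finset.exists_lt_of_sum_lt
    simp [hρ.2]
  exact Finset.sum_pos' (fun i _ => C.beliefWeight_nonneg hρ i)
    ⟨i, Finset.mem_univ i, mul_pos hi (Real.exp_pos _)⟩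

theorem closedFormBelief_mem (C : ModelClass ι Dec Obs) (η : ℝ) (p : Measure Dec) {ρ : ι → ℝ}
    (hρ : ρ ∈ stdSimplex ℝ ι) : C.closedFormBelief η p ρ ∈ stdSimplex ℝ ι := by
  have hZ := C.sum_beliefWeight_pos (η := η) (p := p) hρ
  refine ⟨fun i => div_nonneg (C.beliefWeight_nonneg hρ i) hZ.le, ?_⟩
  simp only [closedFormBelief]
  rw [← Finset.sum_div, div_self hZ.ne']

theorem posterior_mem (C : ModelClass ι Dec Obs) {μ : ι → ℝ} (hμ : μ ∈ stdSimplex ℝ ι) (π : Dec)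
    (o : Obs) : C.posterior μ π o ∈ stdSimplex ℝ ι := by
  by_cases h : ∑ j, μ j * (C.lik j π o : ℝ) = 0
  · have : C.posterior μ π o = μ := funext fun i => by simp [posterior, h]
    rwa [this]
  · have h0 : ∀ j, 0 ≤ μ j * (C.lik j π o : ℝ) :=
      fun j => mul_nonneg (hμ.1 j) (NNReal.coe_nonneg _)
    refine ⟨fun i => ?_, ?_⟩
    · rw [posterior, if_neg h]
      exact div_nonneg (h0 i) (Finset.sum_nonneg fun j _ => h0 j)
    · simp only [posterior, if_neg h]
      rw [← Finset.sum_div, div_self h]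

theorem reference_mem [Nonempty ι] (C : ModelClass ι Dec Obs) (η : ℝ) (alg : Algorithm Dec Obs)
    (t : ℕ) (h : Fin t → Dec × Obs) : C.reference η alg t h ∈ stdSimplex ℝ ι := by
  induction t with
  | zero =>
    refine ⟨fun i => ?_, ?_⟩
    · simp only [reference]; positivity
    · simp [reference]
  | succ t ih =>
    rw [reference]
    exact C.posterior_mem (C.closedFormBelief_mem _ _ (ih _)) _ _

section Induced

variable [MeasurableSingletonClass Dec]

theorem integral_inducedDecision (C : ModelClass ι Dec Obs) {w : ι → ℝ} (hw : ∀ i, 0 ≤ w i)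
    (g : Dec → ℝ) : ∫ π, g π ∂(C.inducedDecision w) = ∑ j, w j * g (C.opt j) := by
  rw [inducedDecision, integral_finsetSum_measure]
  · refine Finset.sum_congr rfl fun j _ => ?_
    rw [integral_smul_measure, integral_dirac, ENNReal.toReal_ofReal (hw j), smul_eq_mul]
  · exact fun j _ => (integrable_dirac (by simp)).smul_measure ENNReal.ofReal_ne_top

theorem lintegral_inducedDecision (C : ModelClass ι Dec Obs) (w : ι → ℝ) (g : Dec → ENNReal) :
    ∫⁻ π, g π ∂(C.inducedDecision w) = ∑ j, ENNReal.ofReal (w j) * g (C.opt j) := by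
  rw [inducedDecision, lintegral_finsetSum_measure]
  refine Finset.sum_congr rfl fun j _ => ?_
  rw [lintegral_smul_measure, lintegral_dirac, smul_eq_mul]

theorem le_decTS (C : ModelClass ι Dec Obs) (hf : ∀ i π, C.meanReward i π ∈ Set.Icc (0 : ℝ) 1)
    {γ : ℝ} (hγ : 0 < γ) {w μ : ι → ℝ} (hw : w ∈ stdSimplex ℝ ι) (hμ : μ ∈ stdSimplex ℝ ι) :
    ∑ i, μ i * ((C.meanReward i (C.opt i) - ∑ j, μ j * C.meanReward i (C.opt j))
      - 1 / γ * ∑ j, μ j * hellingerSq (C.model i (C.opt j)) (C.mixture w (C.opt j)))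
      ≤ C.decTS γ := by
  have hbound : ∀ w ∈ stdSimplex ℝ ι, ∀ μ ∈ stdSimplex ℝ ι,
      ∫ π, ∑ i, μ i * (C.meanReward i (C.opt i) - C.meanReward i π
        - 1 / γ * hellingerSq (C.model i π) (C.mixture w π)) ∂(C.inducedDecision μ) ≤ 1 := by
    intro w hw μ hμ
    rw [C.integral_inducedDecision hμ.1]
    have hle : ∀ j, ∑ i, μ i * (C.meanReward i (C.opt i) - C.meanReward i (C.opt j)
        - 1 / γ * hellingerSq (C.model i (C.opt j)) (C.mixture w (C.opt j))) ≤ 1 := by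
      intro j
      refine (Finset.sum_le_sum fun i _ => ?_).trans hμ.2.le
      refine mul_le_of_le_one_right (hμ.1 i) ?_
      have h1 := (hf i (C.opt i)).2
      have h2 := (hf i (C.opt j)).1
      have h3 := mul_nonneg (one_div_pos.2 hγ).le
        (hellingerSq_nonneg (C.model i (C.opt j)) (C.mixture w (C.opt j)))
      linarith
    calc _ ≤ ∑ j, μ j * 1 :=
          Finset.sum_le_sum fun j _ => mul_le_mul_of_nonneg_left (hle j) (hμ.1 j)
      _ = 1 := by simp [hμ.2]
  have hne : Nonempty (stdSimplex ℝ ι) := ⟨⟨μ, hμ⟩⟩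
  have heq : ∑ i, μ i * ((C.meanReward i (C.opt i) - ∑ j, μ j * C.meanReward i (C.opt j))
      - 1 / γ * ∑ j, μ j * hellingerSq (C.model i (C.opt j)) (C.mixture w (C.opt j)))
      = ∫ π, ∑ i, μ i * (C.meanReward i (C.opt i) - C.meanReward i π
        - 1 / γ * hellingerSq (C.model i π) (C.mixture w π)) ∂(C.inducedDecision μ) := by
    rw [C.integral_inducedDecision hμ.1]
    simp_rw [Finset.mul_sum]
    rw [Finset.sum_comm]
    refine Finset.sum_congr rfl fun i _ => ?_
    have h : C.meanReward i (C.opt i) = ∑ j, μ j * C.meanReward i (C.opt i) := by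
      rw [← Finset.sum_mul, hμ.2, one_mul]
    conv_lhs => rw [h]
    rw [← Finset.sum_sub_distrib, ← Finset.sum_sub_distrib, Finset.mul_sum]
    exact Finset.sum_congr rfl fun j _ => by ring
  rw [heq, decTS]
  -- Both real suprema need an upper bound; rewards in `[0, 1]` supply the bound one.
  refine le_ciSup_of_le ⟨1, ?_⟩ (⟨w, hw⟩ : stdSimplex ℝ ι)
    (le_ciSup_of_le ⟨1, ?_⟩ (⟨μ, hμ⟩ : stdSimplex ℝ ι) le_rfl)
  · rintro _ ⟨w, rfl⟩
    exact ciSup_le fun μ => hbound w.1 w.2 μ.1 μ.2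
  · rintro _ ⟨μ, rfl⟩
    exact hbound w hw μ.1 μ.2

/-- A point mass at one model, with that same model as reference, has objective value zero. -/
theorem decTS_nonneg [Nonempty ι] (C : ModelClass ι Dec Obs)
    (hf : ∀ i π, C.meanReward i π ∈ Set.Icc (0 : ℝ) 1) {γ : ℝ} (hγ : 0 < γ) : 0 ≤ C.decTS γ := by
  classical
  obtain ⟨m⟩ := ‹Nonempty ι›
  have hs : (Pi.single m 1 : ι → ℝ) ∈ stdSimplex ℝ ι := single_mem_stdSimplex ℝ m
  have hmix : ∀ π, C.mixture (Pi.single m 1) π = C.model m π := by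
    intro π
    rw [mixture, Finset.sum_eq_single m (fun j _ hj => by simp [hj]) (by simp)]
    simp
  refine le_trans (le_of_eq ?_) (C.le_decTS hf hγ hs hs)
  simp [Pi.single_apply, hmix, hellingerSq]

end Induced

end ModelClass

end

/-! ### One-round inequality. -/

namespace ModelClass

variable {ι Dec Obs : Type*} [Fintype ι] [MeasurableSpace Dec] [MeasurableSpace Obs]
  [MeasurableSingletonClass Dec]

/-- The real-valued core of the round, with the observation already integrated out. The hypothesis
`hw` treats the explicit and the implicit scheme together; they differ only in `hdec`. -/
theorem sum_log_belief_le (C : ModelClass ι Dec Obs)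
    (hf : ∀ i π, C.meanReward i π ∈ Set.Icc (0 : ℝ) 1) {η : ℝ} (hη : 0 < η) (hη3 : η ≤ 1 / 3)
    {ρ w : ι → ℝ} (hρ : ρ ∈ stdSimplex ℝ ι)
    (hw : w = ρ ∨ w = C.closedFormBelief η (C.inducedDecision w) ρ) {m : ι} (hm : 0 < ρ m) :
    ∑ j, w j * (-Real.log (C.closedFormBelief η (C.inducedDecision w) ρ m)
        - hellingerSq (C.model m (C.opt j))
          (C.mixture (C.closedFormBelief η (C.inducedDecision w) ρ) (C.opt j))
        + η * (C.meanReward m (C.opt m) - C.meanReward m (C.opt j)))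
      ≤ -Real.log (ρ m) + (η * C.decTS (6 * η) + 6 * η ^ 2) := by
  set μ := C.closedFormBelief η (C.inducedDecision w) ρ with hμdef
  have hμ : μ ∈ stdSimplex ℝ ι := C.closedFormBelief_mem _ _ hρ
  have hws : w ∈ stdSimplex ℝ ι := by
    rcases hw with h | h
    · rwa [h]
    · rwa [h]
  set a : ι → ℝ := fun i =>
    C.meanReward i (C.opt i) - ∑ j, w j * C.meanReward i (C.opt j) with ha
  set b : ι → ℝ := fun i =>
    ∑ j, w j * hellingerSq (C.model i (C.opt j)) (C.mixture ρ (C.opt j)) with hb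
  set X : ι → ℝ := fun i => η * a i - 1 / 3 * b i with hX
  have hweight : ∀ i, C.beliefWeight η (C.inducedDecision w) ρ i = ρ i * Real.exp (X i) := by
    intro i
    rw [beliefWeight, C.integral_inducedDecision hws.1, C.integral_inducedDecision hws.1]
  set Z := ∑ i, C.beliefWeight η (C.inducedDecision w) ρ i with hZdef
  have hZ : 0 < Z := C.sum_beliefWeight_pos hρ
  have hμeq : ∀ i, μ i = ρ i * Real.exp (X i) / Z := fun i => by
    rw [hμdef, closedFormBelief, hweight]
  have ha0 : ∀ i, 0 ≤ a i := by
    intro i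
    have h : ∑ j, w j * C.meanReward i (C.opt j) ≤ ∑ j, w j * C.meanReward i (C.opt i) :=
      Finset.sum_le_sum fun j _ =>
        mul_le_mul_of_nonneg_left (C.meanReward_le_opt i _) (hws.1 j)
    rw [← Finset.sum_mul, hws.2, one_mul] at h
    exact sub_nonneg.2 h
  have ha1 : ∀ i, a i ≤ 1 := by
    intro i
    have h : 0 ≤ ∑ j, w j * C.meanReward i (C.opt j) :=
      Finset.sum_nonneg fun j _ => mul_nonneg (hws.1 j) (hf i _).1
    have := (hf i (C.opt i)).2
    simp only [ha]
    linarith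
  have hb0 : ∀ i, 0 ≤ b i := fun i =>
    Finset.sum_nonneg fun j _ => mul_nonneg (hws.1 j) (hellingerSq_nonneg _ _)
  have hb2 : ∀ i, b i ≤ 2 := by
    intro i
    have h : b i ≤ ∑ j, w j * 2 := Finset.sum_le_sum fun j _ =>
      mul_le_mul_of_nonneg_left (C.hellingerSq_model_mixture_le_two hρ i _) (hws.1 j)
    rwa [← Finset.sum_mul, hws.2, one_mul] at h
  have hkl := sum_sub_sqrt_sq_le hZ hρ.1 hρ.2 hμeq hμ.2
  have hkl0 : 0 ≤ ∑ i, (√(μ i) - √(ρ i)) ^ 2 := Finset.sum_nonneg fun i _ => sq_nonneg _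
  have hγ : 0 < 6 * η := by linarith
  have hinv : η * (1 / (6 * η)) = 1 / 6 := by field_simp
  have hdec : 1 / 2 * (Real.log Z + ∑ i, μ i * X i) ≤ η * C.decTS (6 * η) + 6 * η ^ 2 := by
    rcases hw with h | h
    · have h1 := log_add_sum_mul_le hZ hρ.1 hμeq hμ.2
      -- `exp_sub_le` with `u = 2ηa` and `v = 2b/3`: `u ≤ 1` by `η ≤ 1/3`, `v ≤ 4/3` by `b ≤ 2`.
      -- Here `4η²` bounds `u²`, and `v/2 = b/3 = 2η * b/(6η)` produces the DEC parameter `6η`.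
      have h2 : ∑ i, ρ i * Real.exp (2 * X i)
          ≤ ∑ i, (2 * (η * (ρ i * (a i - 1 / (6 * η) * b i))) + ρ i * (1 + 4 * η ^ 2)) := by
        refine Finset.sum_le_sum fun i _ => ?_
        have hu : 0 ≤ 2 * η * a i := by have := ha0 i; positivity
        have hu1 : 2 * η * a i ≤ 1 := by nlinarith [ha0 i, ha1 i]
        have he := exp_sub_le hu hu1 (v := 2 / 3 * b i) (by linarith [hb0 i]) (by linarith [hb2 i])
        have hsq : a i ^ 2 ≤ 1 := by nlinarith [ha0 i, ha1 i]
        have he2 : Real.exp (2 * X i) ≤ 1 + 2 * η * a i + 4 * η ^ 2 - 1 / 3 * b i := by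
          rw [show 2 * X i = 2 * η * a i - 2 / 3 * b i by simp only [hX]; ring]
          nlinarith [mul_le_mul_of_nonneg_left hsq (sq_nonneg η)]
        refine (mul_le_mul_of_nonneg_left he2 (hρ.1 i)).trans (le_of_eq ?_)
        linear_combination (2 * ρ i * b i) * hinv
      rw [Finset.sum_add_distrib, ← Finset.sum_mul, hρ.2, ← Finset.mul_sum, ← Finset.mul_sum] at h2
      have h3 := C.le_decTS hf hγ hρ hρ
      have h4 : ∑ i, ρ i * (a i - 1 / (6 * η) * b i) ≤ C.decTS (6 * η) := by
        simp only [ha, hb, h]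
        exact h3
      have h5 := mul_le_mul_of_nonneg_left h4 hη.le
      nlinarith [sq_nonneg η]
    · have h3 := C.le_decTS hf hγ hρ hμ
      have h4 : ∑ i, μ i * (a i - 1 / (6 * η) * b i) ≤ C.decTS (6 * η) := by
        simp only [ha, hb, h]
        exact h3
      -- Only half of the Hellinger penalty in `X` is kept. With `log Z ≤ ∑ μ X`, from `hkl` and
      -- `hkl0`, this closes the case without any `η²` term.
      have h5 : ∑ i, μ i * X i ≤ ∑ i, η * (μ i * (a i - 1 / (6 * η) * b i)) := by
        refine Finset.sum_le_sum fun i _ => ?_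
        have h6 := mul_nonneg (hμ.1 i) (hb0 i)
        have h7 : η * (μ i * (a i - 1 / (6 * η) * b i)) = μ i * X i + 1 / 6 * (μ i * b i) := by
          simp only [hX]
          linear_combination (-(μ i * b i)) * hinv
        linarith
      rw [← Finset.mul_sum] at h5
      have h6 := mul_le_mul_of_nonneg_left h4 hη.le
      nlinarith [sq_nonneg η]
  have hlogμ : Real.log (μ m) = Real.log (ρ m) + X m - Real.log Z := by
    rw [hμeq, Real.log_div (by positivity) hZ.ne', Real.log_mul hm.ne' (Real.exp_pos _).ne',
      Real.log_exp]
  have hcompare := fun j => C.hellingerSq_mixture_le hρ hμ m (C.opt j)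
  have hstep : ∑ j, w j * (-Real.log (μ m)
        - hellingerSq (C.model m (C.opt j)) (C.mixture μ (C.opt j))
        + η * (C.meanReward m (C.opt m) - C.meanReward m (C.opt j)))
      ≤ ∑ j, (w j * (-Real.log (μ m) + 1 / 2 * (∑ i, μ i * X i - Real.log Z)
          + η * C.meanReward m (C.opt m))
        - η * (w j * C.meanReward m (C.opt j))
        - 1 / 3 * (w j * hellingerSq (C.model m (C.opt j)) (C.mixture ρ (C.opt j)))) := by
    refine Finset.sum_le_sum fun j _ => ?_
    have h1 : -hellingerSq (C.model m (C.opt j)) (C.mixture μ (C.opt j))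
        ≤ 1 / 2 * (∑ i, μ i * X i - Real.log Z)
          - 1 / 3 * hellingerSq (C.model m (C.opt j)) (C.mixture ρ (C.opt j)) := by
      linarith [hcompare j]
    have h2 := mul_le_mul_of_nonneg_left h1 (hws.1 j)
    linarith
  -- After averaging over `w`, the regret and the distance to the `ρ`-mixture cancel against `X m`,
  -- leaving the quantity bounded in `hdec`.
  refine hstep.trans ?_
  rw [Finset.sum_sub_distrib, Finset.sum_sub_distrib, ← Finset.sum_mul, hws.2, ← Finset.mul_sum,
    ← Finset.mul_sum, hlogμ]
  have hXm : X m = η * (C.meanReward m (C.opt m) - ∑ j, w j * C.meanReward m (C.opt j))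
    - 1 / 3 * ∑ j, w j * hellingerSq (C.model m (C.opt j)) (C.mixture ρ (C.opt j)) := rfl
  rw [hXm]
  linarith

/-- One round: the expected logarithmic loss of the next reference distribution and the
instantaneous regret are paid for by the current logarithmic loss. -/
theorem lintegral_round_le (C : ModelClass ι Dec Obs)
    (hf : ∀ i π, C.meanReward i π ∈ Set.Icc (0 : ℝ) 1) {η : ℝ} (hη : 0 < η) (hη3 : η ≤ 1 / 3)
    {ρ w : ι → ℝ} (hρ : ρ ∈ stdSimplex ℝ ι)
    (hw : w = ρ ∨ w = C.closedFormBelief η (C.inducedDecision w) ρ) (m : ι) :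
    ∫⁻ π, ∫⁻ o, (logLoss (C.posterior (C.closedFormBelief η (C.inducedDecision w) ρ) π o m)
        + ENNReal.ofReal (η * (C.meanReward m (C.opt m) - C.meanReward m π)))
        ∂(C.model m π) ∂(C.inducedDecision w)
      ≤ logLoss (ρ m) + ENNReal.ofReal (η * C.decTS (6 * η) + 6 * η ^ 2) := by
  rcases (hρ.1 m).eq_or_lt with hm | hm
  -- Zero prior weight makes the right side infinite, so positivity of the reference at `m` need not
  -- be tracked along histories.
  · simp [logLoss, ← hm]
  have hreal := C.sum_log_belief_le hf hη hη3 hρ hw hm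
  set μ := C.closedFormBelief η (C.inducedDecision w) ρ with hμdef
  have hμ : μ ∈ stdSimplex ℝ ι := C.closedFormBelief_mem _ _ hρ
  have hw0 : ∀ j, 0 ≤ w j := by
    rcases hw with h | h
    · rw [h]; exact hρ.1
    · rw [h]; exact hμ.1
  have hμm : 0 < μ m :=
    div_pos (mul_pos hm (Real.exp_pos _)) (C.sum_beliefWeight_pos hρ)
  have hr : ∀ π, 0 ≤ η * (C.meanReward m (C.opt m) - C.meanReward m π) := fun π =>
    mul_nonneg hη.le (sub_nonneg.2 (C.meanReward_le_opt m π))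
  rw [C.lintegral_inducedDecision]
  have hterm : ∀ j, 0 ≤ -Real.log (μ m)
      - hellingerSq (C.model m (C.opt j)) (C.mixture μ (C.opt j))
      + η * (C.meanReward m (C.opt m) - C.meanReward m (C.opt j)) := fun j =>
    add_nonneg (C.lintegral_logLoss_posterior_le hμ hμm (C.opt j)).1 (hr _)
  calc _ ≤ ∑ j, ENNReal.ofReal (w j * (-Real.log (μ m)
        - hellingerSq (C.model m (C.opt j)) (C.mixture μ (C.opt j))
        + η * (C.meanReward m (C.opt m) - C.meanReward m (C.opt j)))) := by
        refine Finset.sum_le_sum fun j _ => ?_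
        have := (C.isMarkov m).isProbabilityMeasure (C.opt j)
        obtain ⟨h0, hle⟩ := C.lintegral_logLoss_posterior_le hμ hμm (C.opt j)
        rw [ENNReal.ofReal_mul (hw0 j), ENNReal.ofReal_add h0 (hr _),
          lintegral_add_right _ measurable_const]
        simp only [lintegral_const, measure_univ, mul_one]
        gcongr
    _ = ENNReal.ofReal (∑ j, w j * (-Real.log (μ m)
        - hellingerSq (C.model m (C.opt j)) (C.mixture μ (C.opt j))
        + η * (C.meanReward m (C.opt m) - C.meanReward m (C.opt j)))) :=
        (ENNReal.ofReal_sum_of_nonneg fun j _ => mul_nonneg (hw0 j) (hterm j)).symm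
    _ ≤ ENNReal.ofReal (-Real.log (ρ m) + (η * C.decTS (6 * η) + 6 * η ^ 2)) :=
        ENNReal.ofReal_le_ofReal hreal
    _ ≤ _ := by
        rw [logLoss_of_pos hm]
        exact ENNReal.ofReal_add_le

end ModelClass

/-! ### Induction over rounds and the regret bound. -/

theorem measurable_snoc {α : Type*} [MeasurableSpace α] (t : ℕ) :
    Measurable fun x : (Fin t → α) × α => (Fin.snoc x.1 x.2 : Fin (t + 1) → α) := by
  refine measurable_pi_iff.2 fun i => ?_
  refine Fin.lastCases ?_ (fun j => ?_) i
  · simpa using measurable_snd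
  · simp only [Fin.snoc_castSucc]
    exact (measurable_pi_apply j).comp measurable_fst

theorem Algorithm.isProbabilityMeasure_law {Dec Obs : Type*} [MeasurableSpace Dec]
    [MeasurableSpace Obs] (alg : Algorithm Dec Obs) (K : Kernel Dec Obs) [IsMarkovKernel K]
    (t : ℕ) : IsProbabilityMeasure (alg.law K t) := by
  have := alg.isMarkov
  induction t with
  | zero => rw [Algorithm.law]; infer_instance
  | succ t ih =>
    rw [Algorithm.law]
    exact Measure.isProbabilityMeasure_map (measurable_snoc t).aemeasurable

namespace ModelClass

variable {ι Dec Obs : Type*} [Fintype ι] [MeasurableSpace Dec] [MeasurableSpace Obs]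
  [MeasurableSingletonClass Dec]

theorem lintegral_logLoss_add_regret_le (C : ModelClass ι Dec Obs)
    (hf : ∀ i π, C.meanReward i π ∈ Set.Icc (0 : ℝ) 1) {η : ℝ} (hη : 0 < η) (hη3 : η ≤ 1 / 3)
    {alg : Algorithm Dec Obs} (halg : C.IsMAPS η alg) (m : ι) (T : ℕ) :
    ∫⁻ h, (logLoss (C.reference η alg T h m)
        + ∑ t, ENNReal.ofReal (η * (C.meanReward m (C.opt m) - C.meanReward m (h t).1)))
        ∂(alg.law (C.model m) T)
      ≤ logLoss (1 / (Fintype.card ι : ℝ))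
        + T * ENNReal.ofReal (η * C.decTS (6 * η) + 6 * η ^ 2) := by
  have hne : Nonempty ι := ⟨m⟩
  have hmarkov := alg.isMarkov
  have := C.isMarkov m
  induction T with
  | zero =>
    have := alg.isProbabilityMeasure_law (C.model m) 0
    simp [reference]
  | succ t ih =>
    have hprob := alg.isProbabilityMeasure_law (C.model m) t
    rw [Algorithm.law]
    refine (lintegral_map_le _ _).trans ((lintegral_compProd_le _ _ _).trans ?_)
    have hround : ∀ h : Fin t → Dec × Obs,
        ∫⁻ x, (logLoss (C.posterior (C.closedFormBelief η (alg.play t h) (C.reference η alg t h))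
            x.1 x.2 m)
          + ENNReal.ofReal (η * (C.meanReward m (C.opt m) - C.meanReward m x.1)))
          ∂((alg.play t ⊗ₖ Kernel.prodMkLeft (Fin t → Dec × Obs) (C.model m)) h)
        ≤ logLoss (C.reference η alg t h m)
          + ENNReal.ofReal (η * C.decTS (6 * η) + 6 * η ^ 2) := by
      intro h
      refine (lintegral_kernel_compProd_le _ _ _ _).trans ?_
      simp only [Kernel.prodMkLeft_apply]
      rcases halg with hplay | hplay
      · rw [hplay t h]
        exact C.lintegral_round_le hf hη hη3 (C.reference_mem η alg t h) (Or.inl rfl) m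
      · have hb : C.belief η alg t h = C.closedFormBelief η
            (C.inducedDecision (C.belief η alg t h)) (C.reference η alg t h) := by
          rw [← hplay t h]; rfl
        rw [hplay t h]
        exact C.lintegral_round_le hf hη hη3 (C.reference_mem η alg t h) (Or.inr hb) m
    calc _ ≤ ∫⁻ h, (logLoss (C.reference η alg t h m)
          + ∑ s, ENNReal.ofReal (η * (C.meanReward m (C.opt m) - C.meanReward m (h s).1))
          + ENNReal.ofReal (η * C.decTS (6 * η) + 6 * η ^ 2)) ∂(alg.law (C.model m) t) := by
          refine lintegral_mono fun h => ?_
          simp only [reference, Fin.init_snoc, Fin.snoc_last, Fin.sum_univ_castSucc,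
            Fin.snoc_castSucc]
          -- For a fixed history the past regret is constant in the new pair, so it can be split off
          -- although the loss is not known to be measurable.
          simp only [add_comm (∑ s : Fin t, _) (ENNReal.ofReal _), ← add_assoc]
          rw [lintegral_add_right _ measurable_const, lintegral_const, measure_univ, mul_one]
          refine (add_le_add_left (hround h) _).trans (le_of_eq ?_)
          ring
      _ ≤ _ := by
          rw [lintegral_add_right _ measurable_const, lintegral_const, measure_univ, mul_one]
          refine (add_le_add_left ih _).trans (le_of_eq ?_)
          push_cast
          ring

end ModelClass

theorem theorem7p4 {ι Dec Obs : Type*} [Fintype ι]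
    [MeasurableSpace Dec] [MeasurableSingletonClass Dec] [MeasurableSpace Obs]
    (C : ModelClass ι Dec Obs)
    (hf : ∀ i π, C.meanReward i π ∈ Set.Icc (0 : ℝ) 1)
    (η : ℝ) (hη : 0 < η) (hη3 : η ≤ 1 / 3)
    (alg : Algorithm Dec Obs) (halg : C.IsMAPS η alg)
    (m : ι) (T : ℕ) :
    C.regret alg m T ≤
      Real.log (Fintype.card ι) / η + C.decTS (6 * η) * T + 6 * η * T := by
  have hne : Nonempty ι := ⟨m⟩
  have hneD : Nonempty Dec := ⟨C.opt m⟩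
  have hdec := C.decTS_nonneg hf (γ := 6 * η) (by linarith)
  have hcard : (1 : ℝ) ≤ Fintype.card ι := by exact_mod_cast Fintype.card_pos (α := ι)
  have hlog : 0 ≤ Real.log (Fintype.card ι) := Real.log_nonneg hcard
  have hc : 0 ≤ η * C.decTS (6 * η) + 6 * η ^ 2 := by positivity
  have hmain : ∫⁻ h, ENNReal.ofReal (∑ t, η * (C.meanReward m (C.opt m) - C.meanReward m (h t).1))
      ∂(alg.law (C.model m) T)
      ≤ ENNReal.ofReal (Real.log (Fintype.card ι) + T * (η * C.decTS (6 * η) + 6 * η ^ 2)) := by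
    calc _ ≤ _ := lintegral_mono fun h => ?_
      _ ≤ _ := C.lintegral_logLoss_add_regret_le hf hη hη3 halg m T
      _ = _ := ?_
    · rw [ENNReal.ofReal_sum_of_nonneg fun t _ =>
        mul_nonneg hη.le (sub_nonneg.2 (C.meanReward_le_opt m _))]
      exact le_add_self
    · rw [logLoss_of_pos (by positivity), one_div, Real.log_inv, neg_neg,
        ENNReal.ofReal_add hlog (by positivity), ENNReal.ofReal_mul (Nat.cast_nonneg T),
        ENNReal.ofReal_natCast]
  rw [ModelClass.regret]
  refine ciSup_le fun π' => ?_
  -- Holds without integrability, since the Bochner integral then defaults to zero.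
  refine (integral_le_toReal_lintegral_ofReal _ _).trans ?_
  have hle : ∫⁻ h, ENNReal.ofReal (∑ _t : Fin T, C.meanReward m π'
        - ∑ t : Fin T, C.meanReward m (h t).1) ∂(alg.law (C.model m) T)
      ≤ ENNReal.ofReal (η⁻¹ * (Real.log (Fintype.card ι)
        + T * (η * C.decTS (6 * η) + 6 * η ^ 2))) := by
    rw [ENNReal.ofReal_mul (by positivity)]
    refine le_trans ?_ (mul_le_mul_right hmain _)
    rw [← lintegral_const_mul' _ _ ENNReal.ofReal_ne_top]
    refine lintegral_mono fun h => ?_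
    rw [← ENNReal.ofReal_mul (by positivity), ← Finset.mul_sum, inv_mul_cancel_left₀ hη.ne',
      ← Finset.sum_sub_distrib]
    exact ENNReal.ofReal_le_ofReal (Finset.sum_le_sum fun t _ =>
      sub_le_sub_right (C.meanReward_le_opt m π') _)
  refine (ENNReal.toReal_mono ENNReal.ofReal_ne_top hle).trans (le_of_eq ?_)
  rw [ENNReal.toReal_ofReal (by positivity)]
  field_simp
  ring
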